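/- Let $\alpha>1$, $\bar\theta\in(0,\pi)$, $k>0$, $x_2(0)<0$, $\dot x_1(0)>0$, $\dot x_2(0)>0$. Let $K=\{x\in\mathbb R^2: x_1\le 0,\ x_1\cos\bar\theta+x_2\sin\bar\theta\le 0\}$, let $P_K$ be the orthogonal projection onto $K$, and let $G(u,v)=\bigl(v\cdot(u-P_Ku)\bigr)(u-P_Ku)/|u-P_Ku|^2$ if $u\notin K$, $G(u,v)=0$ if $u\in K$. Consider the penalized problem $$\ddot u+2\alpha\sqrt k\,G(u,\dot u)+k(u-P_Ku)=0,\qquad u(0)=(0,x_2(0)),\quad \dot u(0)=(\dot x_1(0),\dot x_2(0)),$$ where $u$ is $C^1$ and the equation is understood in integrated form. Put $$\Delta=\alpha^2-1,\quad \xi_1=-\alpha+\sqrt\Delta,\quad \xi_2=-\alpha-\sqrt\Delta,\quad t_0=-\frac{x_2(0)}{\dot x_2(0)},$$ $$\eta=e^{\xi_1t_0\sqrt k/2},\quad \varepsilon=e^{(\xi_2-\xi_1)t_0\sqrt k},\quad E=\frac{\dot x_1(0)^2\dot x_2(0)^2}{4\Delta}.$$ Consider the scaled polar equations, for $R>0$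 and $\Theta$ on $[0,\infty)$, $$\ddot R-\frac{E(1-\varepsilon)^2}{R^3}+2\alpha\dot R+R=0,\qquad \dot\Theta=\frac{\sqrt E\,(1-\varepsilon)}{R^2},$$ $$R(0)=\frac{\eta\,\dot x_1(0)(1-\varepsilon)}{2\sqrt\Delta},\qquad \dot R(0)=\frac{\eta\,\dot x_1(0)\,\xi_1(1-\varepsilon\xi_2/\xi_1)}{2\sqrt\Delta},\qquad \Theta(0)=0.$$ Then these equations have a solution $(R,\Theta)$ on all of $[0,\infty)$, and for every such solution there exists a time $\bar\tau\in(0,\infty)$ such that $\Theta(\bar\tau)=\bar\theta$. Moreover, up to this time $(R,\Theta)$ are the scaled polar coordinates of the penalized motion: identifying $\mathbb R^2$ with $\mathbb C$, every solution $u$ of the penalized problem on an interval $[0,T]$ satisfies $$u(t)=\frac{\eta R(\tau)}{\sqrt k}\,e^{i\Theta(\tau)},\qquad t=t_0+\frac{\tau}{\sqrt k},$$ for all $\tau\in[0,\bar\tau]$ with $t_0+\tau/\sqrt k\le T$. -/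

import Mathlib

open Set

noncomputable section

namespace PenaltyCorner

/-- The data of the penalized problem: damping `α`, opening parameter `θbar`, stiffness `k`, and
the initial position `(0, x₂0)` and initial velocity `(v₁, v₂)`.  The plane is identified with `ℂ`. -/
structure ProblemData where
  α : ℝ
  θbar : ℝ
  k : ℝ
  x₂0 : ℝ
  v₁ : ℝ
  v₂ : ℝ

/-- The angular domain `K`. -/
def angularDomain (θbar : ℝ) : Set ℂ :=
  {x | x.re ≤ 0 ∧ x.re * Real.cos θbar + x.im * Real.sin θbar ≤ 0}

/-- A point of `K` nearest to `x`; for a nonempty closed convex set `K` there is exactly one. -/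
def proj (K : Set ℂ) (x : ℂ) : ℂ :=
  Classical.epsilon fun y => y ∈ K ∧ ∀ z ∈ K, ‖x - y‖ ≤ ‖x - z‖

open Classical in
/-- The damping direction `G(u, v)`. -/
def damping (K : Set ℂ) (u v : ℂ) : ℂ :=
  if u ∈ K then 0
  else (inner ℝ v (u - proj K u) / ‖u - proj K u‖ ^ 2) • (u - proj K u)

namespace ProblemData

variable (p : ProblemData)

/-- The acceleration `-2α√k G(u, v) - k (u - P_K u)` of the penalized problem. -/
def acceleration (u v : ℂ) : ℂ :=
  -((2 * p.α * √p.k) • damping (angularDomain p.θbar) u v)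
    - p.k • (u - proj (angularDomain p.θbar) u)

/-- `u` is a solution on `[0, T]`, with velocity `v`, of the penalized problem
`ü + 2α√k G(u, u̇) + k (u - P_K u) = 0`, `u(0) = (0, x₂0)`, `u̇(0) = (v₁, v₂)`.
Since `G` jumps across the boundary of `K` (where the motion starts), the second-order equation is
required in integrated form. -/
structure IsPenalizedMotionOn (T : ℝ) (u v : ℝ → ℂ) : Prop where
  init_pos : u 0 = ⟨0, p.x₂0⟩
  init_vel : v 0 = ⟨p.v₁, p.v₂⟩
  vel_cont : ContinuousOn v (Icc 0 T)
  vel : ∀ t ∈ Icc 0 T, HasDerivWithinAt u (v t) (Icc 0 T) t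
  integrable : ∀ t ∈ Icc 0 T,
    IntervalIntegrable (fun σ => p.acceleration (u σ) (v σ)) MeasureTheory.volume 0 t
  motion : ∀ t ∈ Icc 0 T, v t = v 0 + ∫ σ in (0 : ℝ)..t, p.acceleration (u σ) (v σ)

def Δ : ℝ := p.α ^ 2 - 1

def ξ₁ : ℝ := -p.α + √p.Δ

def ξ₂ : ℝ := -p.α - √p.Δ

/-- The time at which the motion arrives at the half-line `x₂ = 0`. -/
def t₀ : ℝ := -p.x₂0 / p.v₂

def η : ℝ := Real.exp (p.ξ₁ * p.t₀ * √p.k / 2)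

def ε : ℝ := Real.exp ((p.ξ₂ - p.ξ₁) * p.t₀ * √p.k)

def E : ℝ := p.v₁ ^ 2 * p.v₂ ^ 2 / (4 * p.Δ)

/-- `R > 0` and `Θ` solve on `[0, ∞)` the scaled equations of motion in polar coordinates,
with `V` the derivative of `R`. -/
structure IsScaledMotion (R V Θ : ℝ → ℝ) : Prop where
  pos : ∀ τ ∈ Ici (0 : ℝ), 0 < R τ
  init_R : R 0 = p.η * p.v₁ * (1 - p.ε) / (2 * √p.Δ)
  init_V : V 0 = p.η * p.v₁ * p.ξ₁ * (1 - p.ε * p.ξ₂ / p.ξ₁) / (2 * √p.Δ)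
  init_Θ : Θ 0 = 0
  deriv_R : ∀ τ ∈ Ici (0 : ℝ), HasDerivWithinAt R (V τ) (Ici 0) τ
  deriv_V : ∀ τ ∈ Ici (0 : ℝ), HasDerivWithinAt V
    (p.E * (1 - p.ε) ^ 2 / R τ ^ 3 - 2 * p.α * V τ - R τ) (Ici 0) τ
  deriv_Θ : ∀ τ ∈ Ici (0 : ℝ), HasDerivWithinAt Θ (√p.E * (1 - p.ε) / R τ ^ 2) (Ici 0) τ

end ProblemData

end PenaltyCorner

end

/-!
While the edge `x₁ = 0` is active, the coordinate `x₁` is an overdamped oscillation and `x₂` is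
uniform, so the motion is explicit up to the time `t₀` at which `x₂ = 0`. From then on the nearest
point of `K` is the corner: the force is central and only the radial velocity is damped, so the
angular momentum `R² Θ'` is a constant `c` and the radial motion has the potential
`(R² + (c / R)²) / 2`. The energy decreases, which confines `(R, R')` to a compact subset of
`R > 0`: the radial motion exists for all times, `R` is bounded, and `Θ' = c / R²` is bounded below
by a positive constant, whence `Θ` passes `θbar`.

The discontinuity of `G` is harmless for uniqueness: a penalized motion that agrees with the
explicit candidate at a time `t` lies, right after `t`, in a region where the acceleration is given
by a smooth vector field, so it agrees with the candidate beyond `t`.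
-/

noncomputable section

namespace PenaltyCorner

open Filter Topology NNReal MeasureTheory

section ForwardSolutions

variable {E : Type*} [NormedAddCommGroup E] [NormedSpace ℝ E] {f : E → E}

theorem eqOn_Icc_of_hasDerivWithinAt_of_lipschitzWith {K : ℝ≥0} (hf : LipschitzWith K f)
    {γ₁ γ₂ : ℝ → E} {a b b' : ℝ} (hb : b ≤ b')
    (h₁ : ∀ t ∈ Icc a b, HasDerivWithinAt γ₁ (f (γ₁ t)) (Icc a b) t)
    (h₂ : ∀ t ∈ Icc a b', HasDerivWithinAt γ₂ (f (γ₂ t)) (Icc a b') t) (h : γ₁ a = γ₂ a) :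
    EqOn γ₁ γ₂ (Icc a b) := by
  have hsub : Icc a b ⊆ Icc a b' := Icc_subset_Icc_right hb
  have hmem : ∀ t ∈ Ico a b, Icc a b ∈ 𝓝[≥] t := fun t ht =>
    mem_of_superset (Icc_mem_nhdsGE ht.2) (Icc_subset_Icc_left ht.1)
  have h₂' : ∀ t ∈ Icc a b, HasDerivWithinAt γ₂ (f (γ₂ t)) (Icc a b) t := fun t ht =>
    (h₂ t (hsub ht)).mono hsub
  exact ODE_solution_unique (v := fun _ => f) (fun _ => hf)
    (fun t ht => (h₁ t ht).continuousWithinAt)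
    (fun t ht => (h₁ t (Ico_subset_Icc_self ht)).mono_of_mem_nhdsWithin (hmem t ht))
    (fun t ht => (h₂' t ht).continuousWithinAt)
    (fun t ht => (h₂' t (Ico_subset_Icc_self ht)).mono_of_mem_nhdsWithin (hmem t ht)) h

theorem exists_forward_solution_of_lipschitzWith [CompleteSpace E] {K L : ℝ≥0}
    (hf : LipschitzWith K f) (hL : ∀ x, ‖f x‖ ≤ L) (x₀ : E) :
    ∃ γ : ℝ → E, γ 0 = x₀ ∧ ∀ t ∈ Ici (0 : ℝ), HasDerivWithinAt γ (f (γ t)) (Ici 0) t := by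
  have hex : ∀ N : ℕ, ∃ γ : ℝ → E, γ 0 = x₀ ∧
      ∀ t ∈ Icc (0 : ℝ) N, HasDerivWithinAt γ (f (γ t)) (Icc 0 N) t := fun N =>
    IsPicardLindelof.exists_eq_forall_mem_Icc_hasDerivWithinAt₀ (f := fun _ => f)
      (t₀ := (⟨0, left_mem_Icc.2 N.cast_nonneg⟩ : Icc (0 : ℝ) N)) (a := L * N) (L := L) (K := K)
      { lipschitzOnWith := fun _ _ => hf.lipschitzOnWith
        continuousOn := fun _ _ => continuousOn_const
        norm_le := fun _ _ x _ => hL x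
        mul_max_le := by simp }
  choose γ hγ₀ hγ using hex
  have hglue : ∀ (N : ℕ), ∀ t ∈ Icc (0 : ℝ) N, γ ⌈t⌉₊ t = γ N t := fun N t ht =>
    eqOn_Icc_of_hasDerivWithinAt_of_lipschitzWith hf (Nat.cast_le.2 (Nat.ceil_le.2 ht.2))
      (hγ _) (hγ N) ((hγ₀ _).trans (hγ₀ N).symm) ⟨ht.1, Nat.le_ceil t⟩
  refine ⟨fun t => γ ⌈t⌉₊ t, hγ₀ _, fun t ht => ?_⟩
  obtain ⟨N, hN⟩ := exists_nat_gt t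
  have ht' : t ∈ Icc (0 : ℝ) N := ⟨ht, hN.le⟩
  have hderiv : HasDerivWithinAt (fun t => γ ⌈t⌉₊ t) (f (γ ⌈t⌉₊ t)) (Icc 0 (N : ℝ)) t := by
    rw [hglue N t ht']
    exact (hγ N t ht').congr (hglue N) (hglue N t ht')
  refine hderiv.mono_of_mem_nhdsWithin ?_
  rw [← Ici_inter_Iic]
  exact inter_mem_nhdsWithin _ (Iic_mem_nhds hN)

theorem forall_Ici_mem_of_forall_Icc_mem_imp {X : Type*} [TopologicalSpace X] {C V : Set X}
    (hC : IsClosed C) (hV : IsOpen V) (hCV : C ⊆ V) {γ : ℝ → X} (hγ : ContinuousOn γ (Ici 0))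
    (h₀ : γ 0 ∈ C) (htrap : ∀ T ∈ Ici (0 : ℝ), (∀ t ∈ Icc 0 T, γ t ∈ V) → γ T ∈ C) :
    ∀ t ∈ Ici (0 : ℝ), γ t ∈ C := by
  intro T hT
  have hγT : ContinuousOn γ (Icc 0 T) := hγ.mono Icc_subset_Ici_self
  have hclosed : IsClosed (γ ⁻¹' C ∩ Icc 0 T) := by
    rw [inter_comm]
    exact hγT.preimage_isClosed_of_isClosed isClosed_Icc hC
  refine hclosed.Icc_subset_of_forall_mem_nhdsGT_of_Icc_subset h₀ ?_ (right_mem_Icc.2 hT)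
  intro s hs hsC
  have hev : ∀ᶠ t in 𝓝[>] s, γ t ∈ V :=
    ((hγ s hs.1).mono (Ioi_subset_Ici hs.1)).eventually_mem (hV.mem_nhds (hCV (hsC ⟨hs.1, le_rfl⟩)))
  obtain ⟨e, hse, he⟩ := mem_nhdsGT_iff_exists_Ioo_subset.1 hev
  refine mem_of_superset (Ioo_mem_nhdsGT hse) fun t ht => htrap t (hs.1.trans ht.1.le) ?_
  intro r hr
  rcases le_or_gt r s with hrs | hrs
  · exact hCV (hsC ⟨hr.1, hrs⟩)
  · exact he ⟨hrs, hr.2.trans_lt ht.2⟩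

theorem exists_contDiff_hasCompactSupport_eqOn_nhds [FiniteDimensional ℝ E] {F : Type*}
    [NormedAddCommGroup F] [NormedSpace ℝ F] {f : E → F} {n : ℕ∞} {C U : Set E} (hC : IsCompact C)
    (hU : IsOpen U) (hCU : C ⊆ U) (hf : ContDiffOn ℝ n f U) :
    ∃ g : E → F, ContDiff ℝ n g ∧ HasCompactSupport g ∧ ∀ᶠ x in 𝓝ˢ C, g x = f x := by
  obtain ⟨C', hC', hCC', hC'U⟩ := exists_compact_between hC hU hCU
  obtain ⟨χ, hχ_one, hχ_zero, -⟩ := exists_contMDiffMap_one_nhds_of_subset_interior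
    (n := n) (modelWithCornersSelf ℝ E) hC.isClosed hCC'
  have hsupp : tsupport χ ⊆ C' :=
    closure_minimal (Function.support_subset_iff'.2 hχ_zero) hC'.isClosed
  refine ⟨fun x => χ x • f x, ?_, ?_, ?_⟩
  · refine (contMDiff_of_tsupport fun x hx => ContDiffAt.contMDiffAt ?_).contDiff
    have hxU : x ∈ U := hC'U (hsupp (tsupport_smul_subset_left _ _ hx))
    exact χ.contMDiff.contDiff.contDiffAt.smul (hf.contDiffAt (hU.mem_nhds hxU))
  · exact (HasCompactSupport.intro hC' hχ_zero).smul_right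
  · filter_upwards [hχ_one] with x hx
    rw [hx, one_smul]

theorem exists_forward_solution_of_forall_mem_compact [FiniteDimensional ℝ E] {C U : Set E}
    (hU : IsOpen U) (hf : ContDiffOn ℝ 1 f U) (hC : IsCompact C) (hCU : C ⊆ U) {x₀ : E}
    (hx₀ : x₀ ∈ C)
    (htrap : ∀ γ : ℝ → E, ∀ T ∈ Ici (0 : ℝ), γ 0 = x₀ →
      (∀ t ∈ Icc 0 T, γ t ∈ U ∧ HasDerivWithinAt γ (f (γ t)) (Icc 0 T) t) → γ T ∈ C) :
    ∃ γ : ℝ → E, γ 0 = x₀ ∧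
      ∀ t ∈ Ici (0 : ℝ), γ t ∈ C ∧ HasDerivWithinAt γ (f (γ t)) (Ici 0) t := by
  have : CompleteSpace E := FiniteDimensional.complete ℝ E
  obtain ⟨g, hg, hg_supp, hgf⟩ := exists_contDiff_hasCompactSupport_eqOn_nhds hC hU hCU hf
  obtain ⟨K, hK⟩ := hg.lipschitzWith_of_hasCompactSupport hg_supp one_ne_zero
  obtain ⟨L, hL⟩ := hg_supp.exists_bound_of_continuous hg.continuous
  obtain ⟨γ, hγ₀, hγ⟩ := exists_forward_solution_of_lipschitzWith hK
    (fun x => (hL x).trans L.le_coe_toNNReal) x₀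
  obtain ⟨V, hV, hCV, hVgf⟩ := eventually_nhdsSet_iff_exists.1 (hgf.and (hU.mem_nhdsSet.2 hCU))
  have hγC : ∀ t ∈ Ici (0 : ℝ), γ t ∈ C := by
    refine forall_Ici_mem_of_forall_Icc_mem_imp hC.isClosed hV hCV
      (fun t ht => (hγ t ht).continuousWithinAt) (hγ₀ ▸ hx₀) fun T hT hγV => ?_
    refine htrap γ T hT hγ₀ fun t ht => ⟨(hVgf _ (hγV t ht)).2, ?_⟩
    rw [← (hVgf _ (hγV t ht)).1]
    exact (hγ t ht.1).mono Icc_subset_Ici_self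
  refine ⟨γ, hγ₀, fun t ht => ⟨hγC t ht, ?_⟩⟩
  rw [← (hVgf _ (hCV (hγC t ht))).1]
  exact hγ t ht

theorem exists_hasDerivWithinAt_Ici [CompleteSpace E] {g : ℝ → E} {a : ℝ}
    (hg : ContinuousOn g (Ici a)) :
    ∃ G : ℝ → E, G a = 0 ∧ ∀ t ∈ Ici a, HasDerivWithinAt G (g t) (Ici a) t := by
  have hcont : Continuous fun s => g (max a s) :=
    hg.comp_continuous (continuous_const.max continuous_id) fun s => le_max_left a s
  refine ⟨fun t => ∫ s in a..t, g (max a s), intervalIntegral.integral_same, fun t ht => ?_⟩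
  have hderiv := (hcont.integral_hasStrictDerivAt a t).hasDerivAt
  rw [max_eq_right (mem_Ici.1 ht)] at hderiv
  exact hderiv.hasDerivWithinAt

theorem eventuallyEq_nhdsGE_of_hasDerivWithinAt {F : E → E} {K : ℝ≥0} {N : Set E} {f g : ℝ → E}
    {a b : ℝ} (hab : a < b) (hN : N ∈ 𝓝 (g a)) (hF : LipschitzOnWith K F N)
    (hfc : ContinuousOn f (Icc a b)) (hgc : ContinuousOn g (Icc a b))
    (hf : ∀ᶠ t in 𝓝[≥] a, HasDerivWithinAt f (F (f t)) (Ici t) t)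
    (hg : ∀ᶠ t in 𝓝[≥] a, HasDerivWithinAt g (F (g t)) (Ici t) t) (h : f a = g a) :
    f =ᶠ[𝓝[≥] a] g := by
  have hmem : ∀ {k : ℝ → E}, ContinuousOn k (Icc a b) → N ∈ 𝓝 (k a) → ∀ᶠ t in 𝓝[≥] a, k t ∈ N :=
    fun hk hNk => ((hk a (left_mem_Icc.2 hab.le)).mono_of_mem_nhdsWithin
      (Icc_mem_nhdsGE hab)).eventually_mem hNk
  obtain ⟨c, hac, hc⟩ := mem_nhdsGE_iff_exists_Icc_subset.1 (((hf.and hg).and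
    ((hmem hfc (h ▸ hN)).and (hmem hgc hN))).and (Icc_mem_nhdsGE hab))
  have hsub : Icc a c ⊆ Icc a b := fun t ht => (hc ht).2
  refine mem_of_superset (Icc_mem_nhdsGE hac) (ODE_solution_unique_of_mem_Icc_right
    (v := fun _ => F) (s := fun _ => N) (fun _ _ => hF) (hfc.mono hsub) ?_ ?_ (hgc.mono hsub)
    ?_ ?_ h)
  all_goals intro t ht; obtain ⟨⟨⟨hft, hgt⟩, hfN, hgN⟩, -⟩ := hc (Ico_subset_Icc_self ht)
  exacts [hft, hfN, hgt, hgN]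

theorem eqOn_Icc_of_hasDerivWithinAt_Ici {F : E → E} {f g : ℝ → E} {a b : ℝ}
    (hF : ∀ t ∈ Ico a b, ContDiffAt ℝ 1 F (g t))
    (hfc : ContinuousOn f (Icc a b)) (hgc : ContinuousOn g (Icc a b))
    (hf : ∀ t ∈ Ico a b, f t = g t →
      ∀ᶠ σ in 𝓝[≥] t, HasDerivWithinAt f (F (f σ)) (Ici σ) σ)
    (hg : ∀ t ∈ Ico a b, HasDerivWithinAt g (F (g t)) (Ici t) t) (h : f a = g a) :
    EqOn f g (Icc a b) := by
  have hclosed : IsClosed ({t | f t = g t} ∩ Icc a b) := by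
    rw [inter_comm]
    exact (hfc.prodMk hgc).preimage_isClosed_of_isClosed isClosed_Icc isClosed_diagonal
  refine hclosed.Icc_subset_of_forall_mem_nhdsWithin h ?_
  rintro t ⟨hft, ht⟩
  obtain ⟨K, N, hN, hK⟩ := (hF t ht).exists_lipschitzOnWith
  have hsub : Icc t b ⊆ Icc a b := Icc_subset_Icc_left ht.1
  have hg' : ∀ᶠ σ in 𝓝[≥] t, HasDerivWithinAt g (F (g σ)) (Ici σ) σ :=
    mem_of_superset (Ico_mem_nhdsGE ht.2) fun σ hσ => hg σ ⟨ht.1.trans hσ.1, hσ.2⟩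
  exact nhdsWithin_mono t Ioi_subset_Ici_self (eventuallyEq_nhdsGE_of_hasDerivWithinAt ht.2 hN hK
    (hfc.mono hsub) (hgc.mono hsub) (hf t ht hft) hg' hft)

end ForwardSolutions

theorem eventually_pos_of_hasDerivWithinAt_Ioi {h : ℝ → ℝ} {d t : ℝ}
    (hd : HasDerivWithinAt h d (Ioi t) t) (h₀ : h t = 0) (hpos : 0 < d) :
    ∀ᶠ σ in 𝓝[>] t, 0 < h σ := by
  rw [hasDerivWithinAt_iff_tendsto_slope' self_notMem_Ioi] at hd
  filter_upwards [hd.eventually_const_lt hpos, self_mem_nhdsWithin] with σ hσ hlt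
  rw [slope_def_field, h₀, sub_zero] at hσ
  exact (div_pos_iff_of_pos_right (sub_pos.2 hlt)).1 hσ

/-- `R > 0` solves `R'' = c² / R³ - 2 α R' - R` on `s`, with `V` the derivative of `R`: the distance
to the origin of a planar motion of angular momentum `c` attracted by the origin, when only the
radial velocity is damped. -/
structure IsRadialMotionOn (α c : ℝ) (s : Set ℝ) (R V : ℝ → ℝ) : Prop where
  pos : ∀ t ∈ s, 0 < R t
  deriv_R : ∀ t ∈ s, HasDerivWithinAt R (V t) s t
  deriv_V : ∀ t ∈ s, HasDerivWithinAt V (c ^ 2 / R t ^ 3 - 2 * α * V t - R t) s t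

/-- A radial motion `R` together with the polar angle `Θ`, given by conservation of the angular
momentum `R² Θ' = c`. -/
structure IsPolarMotionOn (α c : ℝ) (s : Set ℝ) (R V Θ : ℝ → ℝ) : Prop
    extends IsRadialMotionOn α c s R V where
  deriv_Θ : ∀ t ∈ s, HasDerivWithinAt Θ (c / R t ^ 2) s t

/-- The vector field of the radial motion, as a function of `(R, R')`. -/
def radialField (α c : ℝ) (q : ℝ × ℝ) : ℝ × ℝ :=
  (q.2, c ^ 2 / q.1 ^ 3 - 2 * α * q.2 - q.1)

/-- The energy of the radial motion. -/
def energy (c R V : ℝ) : ℝ := (V ^ 2 + R ^ 2 + (c / R) ^ 2) / 2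

/-- A compact region of phase space to which states of radial energy at most `H` are confined. -/
def energyBox (c H : ℝ) : Set (ℝ × ℝ) :=
  Icc (|c| / √(2 * H)) √(2 * H) ×ˢ Icc (-√(2 * H)) √(2 * H)

section RadialMotion

variable {α c H R₀ V₀ : ℝ} {s : Set ℝ} {R V Θ : ℝ → ℝ}

theorem contDiffOn_radialField : ContDiffOn ℝ 1 (radialField α c) {q | 0 < q.1} := by
  have hdiv : ContDiffOn ℝ 1 (fun q : ℝ × ℝ => c ^ 2 / q.1 ^ 3) {q | 0 < q.1} :=
    contDiffOn_const.div (contDiffOn_fst.pow 3) fun _ hq => pow_ne_zero 3 (ne_of_gt hq)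
  exact contDiffOn_snd.prodMk ((hdiv.sub (contDiffOn_const.mul contDiffOn_snd)).sub contDiffOn_fst)

theorem energy_pos (hR₀ : R₀ ≠ 0) : 0 < energy c R₀ V₀ := by
  unfold energy
  positivity

theorem sq_le_of_energy_le (h : energy c R₀ V₀ ≤ H) : R₀ ^ 2 ≤ 2 * H := by
  unfold energy at h
  linarith [sq_nonneg V₀, sq_nonneg (c / R₀)]

theorem mem_energyBox (hR₀ : 0 < R₀) (h : energy c R₀ V₀ ≤ H) : (R₀, V₀) ∈ energyBox c H := by
  have hR : |R₀| ≤ √(2 * H) := Real.abs_le_sqrt (sq_le_of_energy_le h)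
  have hV : |V₀| ≤ √(2 * H) := Real.abs_le_sqrt <| by
    unfold energy at h
    linarith [sq_nonneg R₀, sq_nonneg (c / R₀)]
  have hc : |c / R₀| ≤ √(2 * H) := Real.abs_le_sqrt <| by
    unfold energy at h
    linarith [sq_nonneg R₀, sq_nonneg V₀]
  rw [abs_of_pos hR₀] at hR
  rw [abs_div, abs_of_pos hR₀] at hc
  exact ⟨⟨div_le_of_le_mul₀ (hR₀.le.trans hR) hR₀.le ((div_le_iff₀' hR₀).1 hc), hR⟩, abs_le.1 hV⟩

theorem energyBox_subset (hc : c ≠ 0) (hH : 0 < H) : energyBox c H ⊆ {q | 0 < q.1} := fun _ hq =>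
  (div_pos (abs_pos.2 hc) (Real.sqrt_pos.2 (by positivity))).trans_le hq.1.1

theorem IsRadialMotionOn.antitoneOn_energy (h : IsRadialMotionOn α c s R V) (hα : 0 ≤ α)
    (hs : Convex ℝ s) : AntitoneOn (fun t => energy c (R t) (V t)) s := by
  have hder : ∀ t ∈ s, HasDerivWithinAt (fun t => energy c (R t) (V t))
      (-(2 * α * V t ^ 2)) s t := by
    intro t ht
    have hR : R t ≠ 0 := (h.pos t ht).ne'
    have hsum := ((((h.deriv_V t ht).pow 2).add ((h.deriv_R t ht).pow 2)).add
      (((hasDerivWithinAt_const t s c).div (h.deriv_R t ht) hR).pow 2)).div_const 2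
    refine hsum.congr_deriv ?_
    simp only [Pi.div_apply, Nat.add_one_sub_one, pow_one, Nat.cast_ofNat]
    field_simp
    ring
  refine antitoneOn_of_hasDerivWithinAt_nonpos hs (fun t ht => (hder t ht).continuousWithinAt)
    (fun t ht => (hder t (interior_subset ht)).mono interior_subset) fun t _ => ?_
  exact neg_nonpos.2 (by positivity)

theorem IsRadialMotionOn.energy_le (h : IsRadialMotionOn α c (Ici 0) R V) (hα : 0 ≤ α)
    {t : ℝ} (ht : 0 ≤ t) : energy c (R t) (V t) ≤ energy c (R 0) (V 0) :=
  h.antitoneOn_energy hα (convex_Ici 0) self_mem_Ici ht ht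

theorem isRadialMotionOn_iff : IsRadialMotionOn α c s R V ↔
    ∀ t ∈ s, (R t, V t) ∈ {q : ℝ × ℝ | 0 < q.1} ∧
      HasDerivWithinAt (fun t => (R t, V t)) (radialField α c (R t, V t)) s t :=
  ⟨fun h t ht => ⟨h.pos t ht, (h.deriv_R t ht).prodMk (h.deriv_V t ht)⟩, fun h =>
    ⟨fun t ht => (h t ht).1,
      fun t ht => by simpa [radialField] using (h t ht).2.hasFDerivWithinAt.fst.hasDerivWithinAt,
      fun t ht => by simpa [radialField] using (h t ht).2.hasFDerivWithinAt.snd.hasDerivWithinAt⟩⟩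

theorem exists_isRadialMotionOn (hα : 0 ≤ α) (hc : c ≠ 0) (hR₀ : 0 < R₀) :
    ∃ R V : ℝ → ℝ, R 0 = R₀ ∧ V 0 = V₀ ∧ IsRadialMotionOn α c (Ici 0) R V := by
  have hbox : energyBox c (energy c R₀ V₀) ⊆ {q | 0 < q.1} :=
    energyBox_subset hc (energy_pos hR₀.ne')
  obtain ⟨γ, hγ₀, hγ⟩ := exists_forward_solution_of_forall_mem_compact
    (isOpen_lt continuous_const continuous_fst) (contDiffOn_radialField (α := α) (c := c))
    (isCompact_Icc.prod isCompact_Icc) hbox (mem_energyBox hR₀ le_rfl) fun γ T hT hγ₀ hγ => by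
      have h := isRadialMotionOn_iff.2 hγ
      refine mem_energyBox (h.pos T (right_mem_Icc.2 hT)) ?_
      have hle :=
        h.antitoneOn_energy hα (convex_Icc 0 T) (left_mem_Icc.2 hT) (right_mem_Icc.2 hT) hT
      simpa only [hγ₀] using hle
  exact ⟨fun t => (γ t).1, fun t => (γ t).2, congrArg Prod.fst hγ₀, congrArg Prod.snd hγ₀,
    isRadialMotionOn_iff.2 fun t ht => ⟨hbox (hγ t ht).1, (hγ t ht).2⟩⟩

theorem exists_isPolarMotionOn (hα : 0 ≤ α) (hc : c ≠ 0) (hR₀ : 0 < R₀) :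
    ∃ R V Θ : ℝ → ℝ, R 0 = R₀ ∧ V 0 = V₀ ∧ Θ 0 = 0 ∧ IsPolarMotionOn α c (Ici 0) R V Θ := by
  obtain ⟨R, V, hR, hV, h⟩ := exists_isRadialMotionOn (V₀ := V₀) hα hc hR₀
  have hcont : ContinuousOn (fun t => c / R t ^ 2) (Ici 0) :=
    continuousOn_const.div (ContinuousOn.pow (fun t ht => (h.deriv_R t ht).continuousWithinAt) 2)
      fun t ht => pow_ne_zero 2 (h.pos t ht).ne'
  obtain ⟨Θ, hΘ, hΘ'⟩ := exists_hasDerivWithinAt_Ici hcont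
  exact ⟨R, V, Θ, hR, hV, hΘ, h, hΘ'⟩

namespace IsPolarMotionOn

theorem strictMonoOn_angle (h : IsPolarMotionOn α c s R V Θ) (hc : 0 < c) (hs : Convex ℝ s) :
    StrictMonoOn Θ s :=
  strictMonoOn_of_hasDerivWithinAt_pos hs (fun t ht => (h.deriv_Θ t ht).continuousWithinAt)
    (fun t ht => (h.deriv_Θ t (interior_subset ht)).mono interior_subset) fun t ht =>
      div_pos hc (pow_pos (h.pos t (interior_subset ht)) 2)

theorem le_angle_sub_angle (h : IsPolarMotionOn α c (Ici 0) R V Θ) (hα : 0 ≤ α) (hc : 0 ≤ c)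
    {t : ℝ} (ht : 0 ≤ t) : c / (2 * energy c (R 0) (V 0)) * t ≤ Θ t - Θ 0 := by
  have hderiv : ∀ t ∈ interior (Ici (0 : ℝ)), HasDerivAt Θ (c / R t ^ 2) t := fun t ht =>
    (h.deriv_Θ t (interior_subset ht)).hasDerivAt (mem_interior_iff_mem_nhds.1 ht)
  have hbound := (convex_Ici (0 : ℝ)).mul_sub_le_image_sub_of_le_deriv
    (fun t ht => (h.deriv_Θ t ht).continuousWithinAt)
    (fun t ht => (hderiv t ht).differentiableAt.differentiableWithinAt) fun t ht => by
      have hR := h.pos t (interior_subset ht)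
      rw [(hderiv t ht).deriv]
      exact div_le_div_of_nonneg_left hc (by positivity)
        (sq_le_of_energy_le (h.energy_le hα (interior_subset ht)))
  simpa only [sub_zero] using hbound 0 self_mem_Ici t ht ht

theorem tendsto_angle_atTop (h : IsPolarMotionOn α c (Ici 0) R V Θ) (hα : 0 ≤ α) (hc : 0 < c) :
    Tendsto Θ atTop atTop := by
  have hpos : 0 < energy c (R 0) (V 0) := energy_pos (h.pos 0 self_mem_Ici).ne'
  refine tendsto_atTop_mono' atTop ?_ (tendsto_atTop_add_const_right atTop (Θ 0)
    (tendsto_id.const_mul_atTop (show 0 < c / (2 * energy c (R 0) (V 0)) by positivity)))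
  filter_upwards [eventually_ge_atTop 0] with t ht
  exact le_sub_iff_add_le.1 (h.le_angle_sub_angle hα hc.le ht)

theorem exists_angle_eq (h : IsPolarMotionOn α c (Ici 0) R V Θ) (hα : 0 ≤ α) (hc : 0 < c)
    {θ : ℝ} (hθ : Θ 0 < θ) : ∃ t ∈ Ioi (0 : ℝ), Θ t = θ := by
  obtain ⟨t, ht, rfl⟩ := isPreconnected_Ici.intermediate_value_Ici self_mem_Ici
    (le_principal_iff.2 (Ici_mem_atTop 0)) (fun t ht => (h.deriv_Θ t ht).continuousWithinAt)
    (h.tendsto_angle_atTop hα hc) hθ.le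
  exact ⟨t, lt_of_le_of_ne ht fun h0 => hθ.ne (congrArg Θ h0), rfl⟩

end IsPolarMotionOn

end RadialMotion

theorem hasDerivAt_exp_mul (a t : ℝ) :
    HasDerivAt (fun t => Real.exp (a * t)) (a * Real.exp (a * t)) t := by
  simpa [mul_comm] using ((hasDerivAt_id t).const_mul a).exp

theorem hasDerivWithinAt_complex_mk {f g : ℝ → ℝ} {f' g' t : ℝ} {s : Set ℝ}
    (hf : HasDerivWithinAt f f' s t) (hg : HasDerivWithinAt g g' s t) :
    HasDerivWithinAt (fun t => (⟨f t, g t⟩ : ℂ)) ⟨f', g'⟩ s t := by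
  simp only [Complex.mk_eq_add_mul_I]
  exact hf.ofReal_comp.add (hg.ofReal_comp.mul_const Complex.I)

section PolarCoordinates

/-- The curve in the plane with polar coordinates `R` and `Θ`. -/
def polarPos (R Θ : ℝ → ℝ) (t : ℝ) : ℂ := R t * Complex.exp (Complex.I * Θ t)

/-- The logarithmic derivative of `polarPos R Θ` when `R' = V` and `R² Θ' = c`. -/
def polarRate (c : ℝ) (R V : ℝ → ℝ) (t : ℝ) : ℂ := ⟨V t / R t, c / R t ^ 2⟩

variable {α c t : ℝ} {s : Set ℝ} {R V Θ : ℝ → ℝ}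

theorem IsPolarMotionOn.hasDerivWithinAt_polarPos (h : IsPolarMotionOn α c s R V Θ) (ht : t ∈ s) :
    HasDerivWithinAt (polarPos R Θ) (polarRate c R V t * polarPos R Θ t) s t := by
  have hR : (R t : ℂ) ≠ 0 := Complex.ofReal_ne_zero.2 (h.pos t ht).ne'
  refine ((h.deriv_R t ht).ofReal_comp.mul
    ((h.deriv_Θ t ht).ofReal_comp.const_mul Complex.I).cexp).congr_deriv ?_
  rw [polarRate, polarPos, Complex.mk_eq_add_mul_I]
  push_cast
  field_simp

theorem IsRadialMotionOn.hasDerivWithinAt_polarRate (h : IsRadialMotionOn α c s R V) (ht : t ∈ s) :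
    HasDerivWithinAt (polarRate c R V)
      (-(2 * α * (polarRate c R V t).re + 1 : ℝ) - polarRate c R V t ^ 2) s t := by
  have hR : R t ≠ 0 := (h.pos t ht).ne'
  refine (hasDerivWithinAt_complex_mk ((h.deriv_V t ht).div (h.deriv_R t ht) hR)
    ((hasDerivWithinAt_const t s c).div ((h.deriv_R t ht).pow 2)
      (pow_ne_zero 2 hR))).congr_deriv ?_
  apply Complex.ext
  · simp only [polarRate, sq, Complex.sub_re, Complex.neg_re, Complex.ofReal_re, Complex.mul_re]
    field_simp
    ring
  · simp only [polarRate, sq, Complex.sub_im, Complex.neg_im, Complex.ofReal_im, Complex.mul_im,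
      Pi.pow_apply]
    field_simp
    ring

theorem polarPos_ne_zero (hR : R t ≠ 0) : polarPos R Θ t ≠ 0 :=
  mul_ne_zero (Complex.ofReal_ne_zero.2 hR) (Complex.exp_ne_zero _)

theorem polarPos_re : (polarPos R Θ t).re = R t * Real.cos (Θ t) := by
  rw [polarPos, mul_comm Complex.I, Complex.re_ofReal_mul, Complex.exp_ofReal_mul_I_re]

theorem polarPos_im : (polarPos R Θ t).im = R t * Real.sin (Θ t) := by
  rw [polarPos, mul_comm Complex.I, Complex.im_ofReal_mul, Complex.exp_ofReal_mul_I_im]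

end PolarCoordinates

theorem starProjection_span_singleton_mul (w z : ℂ) :
    (Submodule.span ℝ {z}).starProjection (w * z) = w.re • z := by
  rcases eq_or_ne z 0 with rfl | hz
  · simp
  · have hnorm : ‖z‖ ^ 2 ≠ 0 := pow_ne_zero 2 (norm_ne_zero_iff.2 hz)
    have hinner : inner ℝ z (w * z) = w.re * ‖z‖ ^ 2 := by
      rw [Complex.inner, mul_assoc, Complex.mul_conj, Complex.re_mul_ofReal,
        Complex.normSq_eq_norm_sq]
    rw [Submodule.starProjection_singleton, hinner, RCLike.ofReal_real_eq_id, id,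
      mul_div_cancel_right₀ _ hnorm]

theorem damping_of_notMem {K : Set ℂ} {u : ℂ} (hu : u ∉ K) (v : ℂ) :
    damping K u v = (Submodule.span ℝ {u - proj K u}).starProjection v := by
  rw [damping, if_neg hu, Submodule.starProjection_singleton, real_inner_comm]
  rfl

theorem proj_eq_of_inner_nonpos {K : Set ℂ} {x y : ℂ} (hy : y ∈ K)
    (h : ∀ z ∈ K, inner ℝ (x - y) (z - y) ≤ 0) : proj K x = y := by
  have hpyth : ∀ z ∈ K, ‖x - y‖ ^ 2 + ‖z - y‖ ^ 2 ≤ ‖x - z‖ ^ 2 := by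
    intro z hz
    have hexpand := norm_sub_sq_real (x - y) (z - y)
    rw [sub_sub_sub_cancel_right] at hexpand
    linarith [h z hz]
  have hmin : ∀ z ∈ K, ‖x - y‖ ≤ ‖x - z‖ := fun z hz =>
    le_of_sq_le_sq ((le_add_of_nonneg_right (sq_nonneg _)).trans (hpyth z hz)) (norm_nonneg _)
  obtain ⟨hmem, hle⟩ : proj K x ∈ K ∧ ∀ z ∈ K, ‖x - proj K x‖ ≤ ‖x - z‖ :=
    Classical.epsilon_spec (p := fun y => y ∈ K ∧ ∀ z ∈ K, ‖x - y‖ ≤ ‖x - z‖) ⟨y, hy, hmin⟩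
  have hsq : ‖proj K x - y‖ ^ 2 ≤ 0 := by
    linarith [hpyth _ hmem, pow_le_pow_left₀ (norm_nonneg _) (hle y hy) 2]
  rwa [sq_nonpos_iff, norm_sub_eq_zero_iff] at hsq

/-- The cone of normals to `angularDomain θ` at its corner: the directions of polar angle in
`[0, θ]`. -/
def normalCone (θ : ℝ) : Set ℂ :=
  {x | 0 ≤ x.im ∧ 0 ≤ x.re * Real.sin θ - x.im * Real.cos θ}

section Projection

variable {θ : ℝ} {x z : ℂ}

theorem proj_of_re_nonneg_of_im_nonpos (hθ : 0 ≤ Real.sin θ) (hre : 0 ≤ x.re) (him : x.im ≤ 0) :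
    proj (angularDomain θ) x = ⟨0, x.im⟩ := by
  refine proj_eq_of_inner_nonpos ⟨le_rfl, ?_⟩ fun z hz => ?_
  · simpa using mul_nonpos_of_nonpos_of_nonneg him hθ
  · simpa [Complex.inner] using mul_nonpos_of_nonpos_of_nonneg hz.1 hre

theorem inner_nonpos_of_mem_normalCone (hθ : 0 < Real.sin θ) (hx : x ∈ normalCone θ)
    (hz : z ∈ angularDomain θ) : inner ℝ x z ≤ 0 := by
  have hsum : inner ℝ x z * Real.sin θ = z.re * (x.re * Real.sin θ - x.im * Real.cos θ) +
      (z.re * Real.cos θ + z.im * Real.sin θ) * x.im := by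
    simp only [Complex.inner, Complex.mul_re, Complex.conj_re, Complex.conj_im]
    ring
  refine nonpos_of_mul_nonpos_left (hsum.trans_le ?_) hθ
  exact add_nonpos (mul_nonpos_of_nonpos_of_nonneg hz.1 hx.2)
    (mul_nonpos_of_nonpos_of_nonneg hz.2 hx.1)

theorem proj_of_mem_normalCone (hθ : 0 < Real.sin θ) (hx : x ∈ normalCone θ) :
    proj (angularDomain θ) x = 0 := by
  refine proj_eq_of_inner_nonpos ⟨by simp, by simp⟩ fun z hz => ?_
  simpa using inner_nonpos_of_mem_normalCone hθ hx hz

theorem notMem_angularDomain_of_mem_normalCone (hθ : 0 < Real.sin θ) (hx : x ∈ normalCone θ)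
    (hx₀ : x ≠ 0) : x ∉ angularDomain θ := fun h =>
  (real_inner_self_pos.2 hx₀).not_ge (inner_nonpos_of_mem_normalCone hθ hx h)

end Projection

namespace ProblemData

section Acceleration

variable (p : ProblemData)

/-- The acceleration, as a function of position and velocity, while the point of `K` nearest to the
motion lies on the edge `x₁ = 0`. -/
def edgeField (q : ℂ × ℂ) : ℂ :=
  -((2 * p.α * √p.k) • (q.2.re : ℂ)) - p.k • (q.1.re : ℂ)

/-- The acceleration, as a function of position and velocity, while the point of `K` nearest to the
motion is the corner. -/
def cornerField (q : ℂ × ℂ) : ℂ :=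
  -((2 * p.α * √p.k) • (Submodule.span ℝ {q.1}).starProjection q.2) - p.k • q.1

variable {p} {u v : ℂ}

theorem acceleration_of_notMem (hu : u ∉ angularDomain p.θbar) :
    p.acceleration u v = p.cornerField (u - proj (angularDomain p.θbar) u, v) := by
  rw [acceleration, damping_of_notMem hu, cornerField]

theorem acceleration_eq_edgeField (hθ : 0 ≤ Real.sin p.θbar) (hre : 0 < u.re) (him : u.im ≤ 0) :
    p.acceleration u v = p.edgeField (u, v) := by
  have hu : u ∉ angularDomain p.θbar := fun h => h.1.not_gt hre
  have hsub : u - ⟨0, u.im⟩ = (u.re : ℂ) := by apply Complex.ext <;> simp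
  have hproj : (Submodule.span ℝ {(u.re : ℂ)}).starProjection v = (v.re : ℂ) := by
    have h := starProjection_span_singleton_mul (v / u.re) u.re
    rwa [div_mul_cancel₀ _ (Complex.ofReal_ne_zero.2 hre.ne'), Complex.div_ofReal_re,
      Complex.real_smul, ← Complex.ofReal_mul, div_mul_cancel₀ _ hre.ne'] at h
  rw [acceleration_of_notMem hu, proj_of_re_nonneg_of_im_nonpos hθ hre.le him, hsub, cornerField,
    hproj, edgeField]

theorem acceleration_eq_cornerField (hθ : 0 < Real.sin p.θbar) (hu : u ∈ normalCone p.θbar)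
    (hu₀ : u ≠ 0) : p.acceleration u v = p.cornerField (u, v) := by
  rw [acceleration_of_notMem (notMem_angularDomain_of_mem_normalCone hθ hu hu₀),
    proj_of_mem_normalCone hθ hu, sub_zero]

theorem contDiff_edgeField {n : WithTop ℕ∞} : ContDiff ℝ n p.edgeField :=
  ((((Complex.ofRealCLM ∘L Complex.reCLM).contDiff.comp contDiff_snd).const_smul _).neg).sub
    (((Complex.ofRealCLM ∘L Complex.reCLM).contDiff.comp contDiff_fst).const_smul _)

theorem contDiffAt_cornerField {n : WithTop ℕ∞} {q : ℂ × ℂ} (hq : q.1 ≠ 0) :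
    ContDiffAt ℝ n p.cornerField q := by
  have hproj : ContDiffAt ℝ n
      (fun q : ℂ × ℂ => (Submodule.span ℝ {q.1}).starProjection q.2) q := by
    simp only [Submodule.starProjection_singleton]
    exact ((contDiffAt_fst.inner ℝ contDiffAt_snd).div (contDiffAt_fst.norm_sq ℝ)
      (pow_ne_zero 2 (norm_ne_zero_iff.2 hq))).smul contDiffAt_fst
  exact (hproj.const_smul _).neg.sub (contDiffAt_fst.const_smul _)

end Acceleration

namespace IsPenalizedMotionOn

variable {p : ProblemData} {T : ℝ} {u v : ℝ → ℂ} {A : ℂ × ℂ → ℂ} {t : ℝ}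

theorem hasDerivWithinAt_pos (h : p.IsPenalizedMotionOn T u v) (ht : t ∈ Ico 0 T) :
    HasDerivWithinAt u (v t) (Ici t) t :=
  (h.vel t (Ico_subset_Icc_self ht)).mono_of_mem_nhdsWithin
    (mem_of_superset (Icc_mem_nhdsGE ht.2) (Icc_subset_Icc_left ht.1))

theorem continuousWithinAt_vel (h : p.IsPenalizedMotionOn T u v) (ht : t ∈ Ico 0 T) :
    ContinuousWithinAt v (Ici t) t :=
  (h.vel_cont t (Ico_subset_Icc_self ht)).mono_of_mem_nhdsWithin
    (mem_of_superset (Icc_mem_nhdsGE ht.2) (Icc_subset_Icc_left ht.1))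

theorem hasDerivWithinAt_vel (h : p.IsPenalizedMotionOn T u v) (ht : t ∈ Ico 0 T)
    (hA : ContinuousAt A (u t, v t))
    (hacc : ∀ᶠ σ in 𝓝[>] t, p.acceleration (u σ) (v σ) = A (u σ, v σ)) :
    HasDerivWithinAt v (A (u t, v t)) (Ici t) t := by
  have hlim : Tendsto (fun σ => p.acceleration (u σ) (v σ)) (𝓝[>] t) (𝓝 (A (u t, v t))) := by
    refine (hA.tendsto.comp ?_).congr' (hacc.mono fun _ hσ => hσ.symm)
    exact ((h.hasDerivWithinAt_pos ht).continuousWithinAt.mono Ioi_subset_Ici_self).prodMk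
      ((h.continuousWithinAt_vel ht).mono Ioi_subset_Ici_self)
  have hmeas : StronglyMeasurableAtFilter (fun σ => p.acceleration (u σ) (v σ)) (𝓝[>] t) :=
    ⟨Ioc t T, Ioc_mem_nhdsGT ht.2, (h.integrable T
      ⟨ht.1.trans ht.2.le, le_rfl⟩).1.aestronglyMeasurable.mono_set (Ioc_subset_Ioc_left ht.1)⟩
  have hderiv := (intervalIntegral.integral_hasDerivWithinAt_of_tendsto_ae_right (s := Ici t)
    (t := Ioi t) (h.integrable t (Ico_subset_Icc_self ht)) hmeas
    (hlim.mono_left inf_le_left)).const_add (v 0)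
  refine hderiv.congr_of_eventuallyEq ?_ (h.motion t (Ico_subset_Icc_self ht))
  filter_upwards [Icc_mem_nhdsGE ht.2] with σ hσ using h.motion σ ⟨ht.1.trans hσ.1, hσ.2⟩

theorem eventually_hasDerivWithinAt_prodMk (h : p.IsPenalizedMotionOn T u v) (ht : t ∈ Ico 0 T)
    (hA : ContDiffAt ℝ 1 A (u t, v t))
    (hacc : ∀ᶠ σ in 𝓝[>] t, p.acceleration (u σ) (v σ) = A (u σ, v σ)) :
    ∀ᶠ σ in 𝓝[≥] t, HasDerivWithinAt (fun t => (u t, v t)) (v σ, A (u σ, v σ)) (Ici σ) σ := by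
  have hphase : ContinuousWithinAt (fun t => (u t, v t)) (Ici t) t :=
    (h.hasDerivWithinAt_pos ht).continuousWithinAt.prodMk (h.continuousWithinAt_vel ht)
  obtain ⟨e, hte, he⟩ := mem_nhdsGT_iff_exists_Ioo_subset.1 hacc
  filter_upwards [Ico_mem_nhdsGE hte, Ico_mem_nhdsGE ht.2,
    hphase.eventually (hA.eventually (by simp))] with σ hσe hσT hAσ
  have hσ : σ ∈ Ico 0 T := ⟨ht.1.trans hσT.1, hσT.2⟩
  exact (h.hasDerivWithinAt_pos hσ).prodMk (h.hasDerivWithinAt_vel hσ hAσ.continuousAt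
    (mem_of_superset (Ioo_mem_nhdsGT hσe.2) ((Ioo_subset_Ioo_left hσe.1).trans he)))

theorem eqOn_of_acceleration_eq (h : p.IsPenalizedMotionOn T u v) {w w' : ℝ → ℂ} {a b : ℝ}
    (ha : 0 ≤ a) (hb : b ≤ T) (hA : ∀ t ∈ Ico a b, ContDiffAt ℝ 1 A (w t, w' t))
    (hw : ∀ t ∈ Icc a b, HasDerivWithinAt w (w' t) (Icc a b) t)
    (hw' : ∀ t ∈ Icc a b, HasDerivWithinAt w' (A (w t, w' t)) (Icc a b) t)
    (hacc : ∀ t ∈ Ico a b, u t = w t → v t = w' t →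
      ∀ᶠ σ in 𝓝[>] t, p.acceleration (u σ) (v σ) = A (u σ, v σ))
    (hua : u a = w a) (hva : v a = w' a) :
    EqOn (fun t => (u t, v t)) (fun t => (w t, w' t)) (Icc a b) := by
  have hsub : Icc a b ⊆ Icc 0 T := Icc_subset_Icc ha hb
  refine eqOn_Icc_of_hasDerivWithinAt_Ici (F := fun q => (q.2, A q))
    (fun t ht => contDiffAt_snd.prodMk (hA t ht)) ?_ ?_ ?_ ?_ (Prod.ext hua hva)
  · exact fun t ht =>
      (((h.vel t (hsub ht)).continuousWithinAt.prodMk (h.vel_cont t (hsub ht))).mono hsub)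
  · exact fun t ht => (hw t ht).continuousWithinAt.prodMk (hw' t ht).continuousWithinAt
  · intro t ht heq
    obtain ⟨hut, hvt⟩ := Prod.mk.inj heq
    exact h.eventually_hasDerivWithinAt_prodMk ⟨ha.trans ht.1, ht.2.trans_le hb⟩
      (by rw [hut, hvt]; exact hA t ht) (hacc t ht hut hvt)
  · intro t ht
    have hmem : Icc a b ∈ 𝓝[≥] t :=
      mem_of_superset (Icc_mem_nhdsGE ht.2) (Icc_subset_Icc_left ht.1)
    have htI := Ico_subset_Icc_self ht
    exact ((hw t htI).mono_of_mem_nhdsWithin hmem).prodMk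
      ((hw' t htI).mono_of_mem_nhdsWithin hmem)

theorem eventually_pos_of_pos (h : p.IsPenalizedMotionOn T u v) (ht : t ∈ Ico 0 T)
    (L : ℂ →L[ℝ] ℝ) (hL : 0 < L (u t)) : ∀ᶠ σ in 𝓝[>] t, 0 < L (u σ) :=
  ((L.continuous.continuousAt.comp_continuousWithinAt
    (h.hasDerivWithinAt_pos ht).continuousWithinAt).mono Ioi_subset_Ici_self).eventually_const_lt hL

theorem eventually_pos_of_eq_zero (h : p.IsPenalizedMotionOn T u v) (ht : t ∈ Ico 0 T)
    (L : ℂ →L[ℝ] ℝ) (hL₀ : L (u t) = 0) (hL : 0 < L (v t)) : ∀ᶠ σ in 𝓝[>] t, 0 < L (u σ) :=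
  eventually_pos_of_hasDerivWithinAt_Ioi ((L.hasFDerivAt.comp_hasDerivWithinAt t
    (h.hasDerivWithinAt_pos ht)).mono Ioi_subset_Ici_self) hL₀ hL

end IsPenalizedMotionOn

section Constants

variable (p : ProblemData)

/-- The conserved angular momentum `R² Θ'` of the scaled motion. -/
def momentum : ℝ := √p.E * (1 - p.ε)

variable {p}

theorem Δ_pos (hα : 1 < p.α) : 0 < p.Δ :=
  sub_pos.2 (one_lt_pow₀ hα two_ne_zero)

theorem sqrt_Δ_pos (hα : 1 < p.α) : 0 < √p.Δ :=
  Real.sqrt_pos.2 (Δ_pos hα)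

theorem sq_sqrt_Δ (hα : 1 < p.α) : √p.Δ ^ 2 = p.α ^ 2 - 1 :=
  Real.sq_sqrt (Δ_pos hα).le

theorem ξ₁_root (hα : 1 < p.α) : p.ξ₁ ^ 2 + 2 * p.α * p.ξ₁ + 1 = 0 := by
  rw [ξ₁]
  linear_combination sq_sqrt_Δ hα

theorem ξ₂_root (hα : 1 < p.α) : p.ξ₂ ^ 2 + 2 * p.α * p.ξ₂ + 1 = 0 := by
  rw [ξ₂]
  linear_combination sq_sqrt_Δ hα

theorem ξ₁_sub_ξ₂ : p.ξ₁ - p.ξ₂ = 2 * √p.Δ := by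
  rw [ξ₁, ξ₂]
  ring

theorem ξ₂_lt_ξ₁ (hα : 1 < p.α) : p.ξ₂ < p.ξ₁ := by
  linarith [p.ξ₁_sub_ξ₂, sqrt_Δ_pos hα]

theorem ξ₁_ne_zero (hα : 1 < p.α) : p.ξ₁ ≠ 0 := fun h => by
  simpa [h] using ξ₁_root hα

theorem t₀_pos (hx₂ : p.x₂0 < 0) (hv₂ : 0 < p.v₂) : 0 < p.t₀ :=
  div_pos (neg_pos.2 hx₂) hv₂

theorem η_pos : 0 < p.η := Real.exp_pos _

theorem ε_lt_one (hα : 1 < p.α) (hk : 0 < p.k) (hx₂ : p.x₂0 < 0) (hv₂ : 0 < p.v₂) :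
    p.ε < 1 :=
  Real.exp_lt_one_iff.2 <| mul_neg_of_neg_of_pos
    (mul_neg_of_neg_of_pos (sub_neg.2 (ξ₂_lt_ξ₁ hα)) (t₀_pos hx₂ hv₂)) (Real.sqrt_pos.2 hk)

theorem sqrt_E (hv₁ : 0 ≤ p.v₁) (hv₂ : 0 ≤ p.v₂) : √p.E = p.v₁ * p.v₂ / (2 * √p.Δ) := by
  rw [E, Real.sqrt_div (by positivity), ← mul_pow, Real.sqrt_sq (mul_nonneg hv₁ hv₂),
    Real.sqrt_mul zero_le_four, show (4 : ℝ) = 2 ^ 2 by norm_num, Real.sqrt_sq zero_le_two]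

theorem momentum_pos (hα : 1 < p.α) (hk : 0 < p.k) (hx₂ : p.x₂0 < 0) (hv₁ : 0 < p.v₁)
    (hv₂ : 0 < p.v₂) : 0 < p.momentum := by
  have hΔ := sqrt_Δ_pos hα
  rw [momentum, sqrt_E hv₁.le hv₂.le]
  exact mul_pos (by positivity) (sub_pos.2 (ε_lt_one hα hk hx₂ hv₂))

theorem momentum_sq (hα : 1 < p.α) : p.momentum ^ 2 = p.E * (1 - p.ε) ^ 2 := by
  have hΔ := Δ_pos hα
  have hE : 0 ≤ p.E := by unfold E; positivity
  rw [momentum, mul_pow, Real.sq_sqrt hE]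

theorem exp_ξ₁ : Real.exp (p.ξ₁ * √p.k * p.t₀) = p.η ^ 2 := by
  rw [η, ← Real.exp_nat_mul]
  push_cast
  ring_nf

theorem exp_ξ₂ : Real.exp (p.ξ₂ * √p.k * p.t₀) = p.η ^ 2 * p.ε := by
  rw [← exp_ξ₁, ε, ← Real.exp_add]
  ring_nf

end Constants

section EdgePhase

variable (p : ProblemData)

/-- The first coordinate of the motion while the edge `x₁ = 0` is active: the overdamped
oscillation with roots `ξ₁ √k` and `ξ₂ √k`. -/
def edgeCoord (t : ℝ) : ℝ :=
  p.v₁ / (2 * √p.Δ * √p.k) * (Real.exp (p.ξ₁ * √p.k * t) - Real.exp (p.ξ₂ * √p.k * t))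

/-- The derivative of `edgeCoord`. -/
def edgeSpeed (t : ℝ) : ℝ :=
  p.v₁ / (2 * √p.Δ) * (p.ξ₁ * Real.exp (p.ξ₁ * √p.k * t) - p.ξ₂ * Real.exp (p.ξ₂ * √p.k * t))

/-- The motion while the edge `x₁ = 0` is active. -/
def edgePos (t : ℝ) : ℂ := ⟨p.edgeCoord t, p.x₂0 + p.v₂ * t⟩

/-- The velocity of `edgePos`. -/
def edgeVel (t : ℝ) : ℂ := ⟨p.edgeSpeed t, p.v₂⟩

variable {p} {T t : ℝ} {u v : ℝ → ℂ}

theorem hasDerivAt_edgeCoord (hk : 0 < p.k) (t : ℝ) :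
    HasDerivAt p.edgeCoord (p.edgeSpeed t) t := by
  have hk' : √p.k ≠ 0 := (Real.sqrt_pos.2 hk).ne'
  refine (((hasDerivAt_exp_mul (p.ξ₁ * √p.k) t).sub
    (hasDerivAt_exp_mul (p.ξ₂ * √p.k) t)).const_mul _).congr_deriv ?_
  unfold edgeSpeed
  field_simp

theorem hasDerivAt_edgeSpeed (hα : 1 < p.α) (hk : 0 < p.k) (t : ℝ) :
    HasDerivAt p.edgeSpeed (-(2 * p.α * √p.k * p.edgeSpeed t) - p.k * p.edgeCoord t) t := by
  have hk' : √p.k ≠ 0 := (Real.sqrt_pos.2 hk).ne'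
  have hΔ : √p.Δ ≠ 0 := (sqrt_Δ_pos hα).ne'
  refine ((((hasDerivAt_exp_mul (p.ξ₁ * √p.k) t).const_mul p.ξ₁).sub
    ((hasDerivAt_exp_mul (p.ξ₂ * √p.k) t).const_mul p.ξ₂)).const_mul _).congr_deriv ?_
  unfold edgeSpeed edgeCoord
  generalize Real.exp (p.ξ₁ * √p.k * t) = X
  generalize Real.exp (p.ξ₂ * √p.k * t) = Y
  have hsq := Real.mul_self_sqrt hk.le
  generalize √p.k = κ at *
  rw [← hsq]
  field_simp
  linear_combination p.v₁ * X * ξ₁_root hα - p.v₁ * Y * ξ₂_root hα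

theorem hasDerivWithinAt_edgePos (hk : 0 < p.k) (s : Set ℝ) (t : ℝ) :
    HasDerivWithinAt p.edgePos (p.edgeVel t) s t :=
  hasDerivWithinAt_complex_mk (hasDerivAt_edgeCoord hk t).hasDerivWithinAt <| by
    simpa using ((hasDerivWithinAt_id t s).const_mul p.v₂).const_add p.x₂0

theorem hasDerivWithinAt_edgeVel (hα : 1 < p.α) (hk : 0 < p.k) (s : Set ℝ) (t : ℝ) :
    HasDerivWithinAt p.edgeVel (p.edgeField (p.edgePos t, p.edgeVel t)) s t := by
  refine (hasDerivWithinAt_complex_mk (hasDerivAt_edgeSpeed hα hk t).hasDerivWithinAt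
    (hasDerivWithinAt_const t s p.v₂)).congr_deriv ?_
  apply Complex.ext <;> simp [edgeField, edgePos, edgeVel]

theorem edgeCoord_zero : p.edgeCoord 0 = 0 := by
  simp [edgeCoord]

theorem edgeSpeed_zero (hα : 1 < p.α) : p.edgeSpeed 0 = p.v₁ := by
  have hΔ : √p.Δ ≠ 0 := (sqrt_Δ_pos hα).ne'
  simp only [edgeSpeed, mul_zero, Real.exp_zero, mul_one, ξ₁_sub_ξ₂]
  field_simp

theorem edgeCoord_pos (hα : 1 < p.α) (hk : 0 < p.k) (hv₁ : 0 < p.v₁) (ht : 0 < t) :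
    0 < p.edgeCoord t := by
  have hΔ : 0 < √p.Δ := sqrt_Δ_pos hα
  have hξ := ξ₂_lt_ξ₁ hα
  exact mul_pos (by positivity) (sub_pos.2 (by gcongr))

theorem edgePos_im_neg (hv₂ : 0 < p.v₂) (ht : t < p.t₀) : (p.edgePos t).im < 0 := by
  rw [t₀, lt_div_iff₀ hv₂] at ht
  rw [edgePos]
  linarith

theorem edgePos_t₀_im (hv₂ : 0 < p.v₂) : (p.edgePos p.t₀).im = 0 := by
  rw [edgePos, t₀]
  field_simp
  ring

theorem IsPenalizedMotionOn.eventually_acceleration_eq_edgeField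
    (h : p.IsPenalizedMotionOn T u v) (hα : 1 < p.α) (hθ : p.θbar ∈ Ioo 0 Real.pi)
    (hk : 0 < p.k) (hv₁ : 0 < p.v₁) (hv₂ : 0 < p.v₂) (ht : t ∈ Ico 0 T) (ht₀ : t < p.t₀)
    (hut : u t = p.edgePos t) :
    ∀ᶠ σ in 𝓝[>] t, p.acceleration (u σ) (v σ) = p.edgeField (u σ, v σ) := by
  have hre : ∀ᶠ σ in 𝓝[>] t, 0 < Complex.reCLM (u σ) := by
    rcases ht.1.eq_or_lt with rfl | hpos
    · exact h.eventually_pos_of_eq_zero ht _ (by simp [h.init_pos]) (by simpa [h.init_vel])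
    · refine h.eventually_pos_of_pos ht _ ?_
      simpa [hut, edgePos] using edgeCoord_pos hα hk hv₁ hpos
  have him : ∀ᶠ σ in 𝓝[>] t, 0 < (-Complex.imCLM) (u σ) :=
    h.eventually_pos_of_pos ht _ (by simpa [hut] using edgePos_im_neg hv₂ ht₀)
  filter_upwards [hre, him] with σ hreσ himσ
  exact acceleration_eq_edgeField (Real.sin_pos_of_mem_Ioo hθ).le hreσ (neg_pos.1 himσ).le

theorem IsPenalizedMotionOn.eqOn_edgePos (h : p.IsPenalizedMotionOn T u v) (hα : 1 < p.α)
    (hθ : p.θbar ∈ Ioo 0 Real.pi) (hk : 0 < p.k) (hv₁ : 0 < p.v₁) (hv₂ : 0 < p.v₂)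
    (hT : p.t₀ ≤ T) :
    EqOn (fun t => (u t, v t)) (fun t => (p.edgePos t, p.edgeVel t)) (Icc 0 p.t₀) := by
  refine h.eqOn_of_acceleration_eq le_rfl hT (fun t _ => contDiff_edgeField.contDiffAt)
    (fun t _ => hasDerivWithinAt_edgePos hk _ t)
    (fun t _ => hasDerivWithinAt_edgeVel hα hk _ t)
    (fun t ht hut _ => h.eventually_acceleration_eq_edgeField hα hθ hk hv₁ hv₂
      ⟨ht.1, ht.2.trans_le hT⟩ ht.2 hut) ?_ ?_
  · rw [h.init_pos, edgePos, edgeCoord_zero, mul_zero, add_zero]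
  · rw [h.init_vel, edgeVel, edgeSpeed_zero hα]

end EdgePhase

section ScaledMotion

variable {p : ProblemData} {R V Θ : ℝ → ℝ}

theorem IsScaledMotion.isPolarMotionOn (h : p.IsScaledMotion R V Θ) (hα : 1 < p.α) :
    IsPolarMotionOn p.α p.momentum (Ici 0) R V Θ where
  pos := h.pos
  deriv_R := h.deriv_R
  deriv_V := by simpa only [momentum_sq hα] using h.deriv_V
  deriv_Θ := h.deriv_Θ

theorem exists_isScaledMotion (hα : 1 < p.α) (hk : 0 < p.k) (hx₂ : p.x₂0 < 0) (hv₁ : 0 < p.v₁)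
    (hv₂ : 0 < p.v₂) : ∃ R V Θ : ℝ → ℝ, p.IsScaledMotion R V Θ := by
  have hR₀ : 0 < p.η * p.v₁ * (1 - p.ε) / (2 * √p.Δ) :=
    div_pos (mul_pos (mul_pos η_pos hv₁) (sub_pos.2 (ε_lt_one hα hk hx₂ hv₂)))
      (mul_pos two_pos (sqrt_Δ_pos hα))
  obtain ⟨R, V, Θ, hR, hV, hΘ, h⟩ := exists_isPolarMotionOn
    (V₀ := p.η * p.v₁ * p.ξ₁ * (1 - p.ε * p.ξ₂ / p.ξ₁) / (2 * √p.Δ)) (zero_le_one.trans hα.le)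
    (momentum_pos hα hk hx₂ hv₁ hv₂).ne' hR₀
  exact ⟨R, V, Θ, h.pos, hR, hV, hΘ, h.deriv_R, by simpa only [momentum_sq hα] using h.deriv_V,
    h.deriv_Θ⟩

end ScaledMotion

section CornerPhase

variable (p : ProblemData)

/-- The time variable `τ` of the scaled motion. -/
def scaledTime (t : ℝ) : ℝ := √p.k * (t - p.t₀)

/-- The motion while the corner attracts, given by the scaled polar coordinates `R` and `Θ`. -/
def cornerPos (R Θ : ℝ → ℝ) (t : ℝ) : ℂ := (p.η / √p.k) • polarPos R Θ (p.scaledTime t)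

/-- The velocity of `cornerPos`. -/
def cornerVel (R V Θ : ℝ → ℝ) (t : ℝ) : ℂ :=
  (√p.k • polarRate p.momentum R V (p.scaledTime t)) * p.cornerPos R Θ t

variable {p} {R V Θ : ℝ → ℝ} {T t b : ℝ} {u v : ℝ → ℂ}

theorem cornerField_mul (w z : ℂ) :
    p.cornerField (z, w * z) = -(2 * p.α * √p.k * w.re + p.k) • z := by
  rw [cornerField, starProjection_span_singleton_mul, smul_smul, neg_add', sub_smul, neg_smul]

theorem scaledTime_t₀ : p.scaledTime p.t₀ = 0 := by
  rw [scaledTime, sub_self, mul_zero]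

theorem scaledTime_nonneg (ht : p.t₀ ≤ t) : 0 ≤ p.scaledTime t :=
  mul_nonneg (Real.sqrt_nonneg _) (sub_nonneg.2 ht)

theorem strictMono_scaledTime (hk : 0 < p.k) : StrictMono p.scaledTime := fun _ _ h =>
  mul_lt_mul_of_pos_left (sub_lt_sub_right h _) (Real.sqrt_pos.2 hk)

theorem scaledTime_t₀_add_div (hk : 0 < p.k) (τ : ℝ) : p.scaledTime (p.t₀ + τ / √p.k) = τ := by
  rw [scaledTime, add_sub_cancel_left, mul_div_cancel₀ _ (Real.sqrt_pos.2 hk).ne']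

theorem hasDerivWithinAt_comp_scaledTime {f : ℝ → ℂ} {f' : ℂ}
    (hf : HasDerivWithinAt f f' (Ici 0) (p.scaledTime t)) :
    HasDerivWithinAt (fun t => f (p.scaledTime t)) (√p.k • f') (Icc p.t₀ b) t := by
  have hτ : HasDerivAt p.scaledTime √p.k t :=
    (((hasDerivAt_id t).sub_const p.t₀).const_mul √p.k).congr_deriv (mul_one _)
  exact hf.scomp t hτ.hasDerivWithinAt fun s hs => scaledTime_nonneg hs.1

theorem hasDerivWithinAt_cornerPos (h : IsPolarMotionOn p.α p.momentum (Ici 0) R V Θ)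
    (ht : t ∈ Icc p.t₀ b) :
    HasDerivWithinAt (p.cornerPos R Θ) (p.cornerVel R V Θ t) (Icc p.t₀ b) t := by
  refine ((hasDerivWithinAt_comp_scaledTime (h.hasDerivWithinAt_polarPos
    (scaledTime_nonneg ht.1))).const_smul (p.η / √p.k)).congr_deriv ?_
  simp only [cornerVel, cornerPos, Complex.real_smul]
  ring

theorem hasDerivWithinAt_cornerVel (h : IsPolarMotionOn p.α p.momentum (Ici 0) R V Θ)
    (hk : 0 ≤ p.k) (ht : t ∈ Icc p.t₀ b) :
    HasDerivWithinAt (p.cornerVel R V Θ) (p.cornerField (p.cornerPos R Θ t, p.cornerVel R V Θ t))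
      (Icc p.t₀ b) t := by
  have hsq : (√p.k : ℂ) ^ 2 = p.k := by exact_mod_cast Real.sq_sqrt hk
  refine (((hasDerivWithinAt_comp_scaledTime
    (h.hasDerivWithinAt_polarRate (scaledTime_nonneg ht.1))).const_smul √p.k).mul
      (hasDerivWithinAt_cornerPos h ht)).congr_deriv ?_
  rw [show p.cornerVel R V Θ t = _ * _ from rfl, cornerField_mul, Complex.smul_re]
  simp only [Pi.smul_apply, Complex.real_smul, smul_eq_mul]
  push_cast
  linear_combination -p.cornerPos R Θ t * hsq

theorem cornerPos_re (t : ℝ) : (p.cornerPos R Θ t).re =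
    p.η / √p.k * R (p.scaledTime t) * Real.cos (Θ (p.scaledTime t)) := by
  rw [cornerPos, Complex.smul_re, polarPos_re, smul_eq_mul, mul_assoc]

theorem cornerPos_im (t : ℝ) : (p.cornerPos R Θ t).im =
    p.η / √p.k * R (p.scaledTime t) * Real.sin (Θ (p.scaledTime t)) := by
  rw [cornerPos, Complex.smul_im, polarPos_im, smul_eq_mul, mul_assoc]

theorem cornerPos_t₀_add_div (hk : 0 < p.k) (τ : ℝ) : p.cornerPos R Θ (p.t₀ + τ / √p.k) =
    ((p.η * R τ / √p.k : ℝ) : ℂ) * Complex.exp (Complex.I * (Θ τ : ℂ)) := by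
  rw [cornerPos, scaledTime_t₀_add_div hk, polarPos, Complex.real_smul]
  push_cast
  ring

theorem cornerPos_ne_zero (hk : 0 < p.k) (hR : R (p.scaledTime t) ≠ 0) : p.cornerPos R Θ t ≠ 0 :=
  smul_ne_zero (div_pos η_pos (Real.sqrt_pos.2 hk)).ne' (polarPos_ne_zero hR)

namespace IsScaledMotion

theorem cornerPos_t₀ (h : p.IsScaledMotion R V Θ) (hv₂ : 0 < p.v₂) :
    p.cornerPos R Θ p.t₀ = p.edgePos p.t₀ := by
  apply Complex.ext
  · rw [cornerPos_re, scaledTime_t₀, h.init_R, h.init_Θ, Real.cos_zero, edgePos, edgeCoord, exp_ξ₁,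
      exp_ξ₂]
    ring
  · rw [cornerPos_im, scaledTime_t₀, h.init_Θ, Real.sin_zero, mul_zero, edgePos_t₀_im hv₂]

theorem η_mul_init_V (h : p.IsScaledMotion R V Θ) (hα : 1 < p.α) :
    p.η * V 0 = p.edgeSpeed p.t₀ := by
  have hξ := ξ₁_ne_zero hα
  have hΔ := sqrt_Δ_pos hα
  rw [h.init_V, edgeSpeed, exp_ξ₁, exp_ξ₂]
  field_simp

theorem η_mul_momentum (h : p.IsScaledMotion R V Θ) (hv₁ : 0 ≤ p.v₁)
    (hv₂ : 0 ≤ p.v₂) : p.η * p.momentum = p.v₂ * R 0 := by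
  rw [h.init_R, momentum, sqrt_E hv₁ hv₂]
  ring

theorem cornerVel_t₀ (h : p.IsScaledMotion R V Θ) (hα : 1 < p.α) (hk : 0 < p.k)
    (hv₁ : 0 ≤ p.v₁) (hv₂ : 0 ≤ p.v₂) : p.cornerVel R V Θ p.t₀ = p.edgeVel p.t₀ := by
  have hR : R 0 ≠ 0 := (h.pos 0 self_mem_Ici).ne'
  have hk' : √p.k ≠ 0 := (Real.sqrt_pos.2 hk).ne'
  apply Complex.ext
  · rw [cornerVel, Complex.mul_re, cornerPos_re, cornerPos_im, scaledTime_t₀, h.init_Θ,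
      Real.cos_zero, Real.sin_zero, Complex.smul_re, smul_eq_mul, polarRate, edgeVel,
      ← h.η_mul_init_V hα]
    field_simp
    ring
  · rw [cornerVel, Complex.mul_im, cornerPos_re, cornerPos_im, scaledTime_t₀, h.init_Θ,
      Real.cos_zero, Real.sin_zero, Complex.smul_im, smul_eq_mul, polarRate, edgeVel]
    field_simp
    linear_combination √p.k * h.η_mul_momentum hv₁ hv₂

end IsScaledMotion

namespace IsPenalizedMotionOn

theorem eventually_im_pos (hu : p.IsPenalizedMotionOn T u v) (hc : 0 < p.momentum) (hk : 0 < p.k)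
    (ht : t ∈ Ico 0 T) (hR : 0 < R (p.scaledTime t)) (hΘ : Θ (p.scaledTime t) ∈ Ico 0 Real.pi)
    (hut : u t = p.cornerPos R Θ t) (hvt : v t = p.cornerVel R V Θ t) :
    ∀ᶠ σ in 𝓝[>] t, 0 < Complex.imCLM (u σ) := by
  have hη : 0 < p.η := η_pos
  rcases hΘ.1.eq_or_lt with hzero | hpos
  · refine hu.eventually_pos_of_eq_zero ht _ ?_ ?_
    · rw [hut, Complex.imCLM_apply, cornerPos_im, ← hzero, Real.sin_zero, mul_zero]
    · rw [hvt, Complex.imCLM_apply, cornerVel, Complex.mul_im, cornerPos_re, cornerPos_im, ← hzero,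
        Real.sin_zero, Real.cos_zero, Complex.smul_im, polarRate, smul_eq_mul]
      simp only [mul_zero, zero_add]
      positivity
  · refine hu.eventually_pos_of_pos ht _ ?_
    rw [hut, Complex.imCLM_apply, cornerPos_im]
    have hsin := Real.sin_pos_of_pos_of_lt_pi hpos hΘ.2
    positivity

theorem eventually_re_mul_sin_sub_im_mul_cos_pos (hu : p.IsPenalizedMotionOn T u v) (hk : 0 < p.k)
    (ht : t ∈ Ico 0 T) (hR : 0 < R (p.scaledTime t)) {θ : ℝ}
    (hΘ : θ - Θ (p.scaledTime t) ∈ Ioo 0 Real.pi) (hut : u t = p.cornerPos R Θ t) :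
    ∀ᶠ σ in 𝓝[>] t, 0 < (u σ).re * Real.sin θ - (u σ).im * Real.cos θ := by
  have hr : 0 < p.η / √p.k * R (p.scaledTime t) :=
    mul_pos (div_pos η_pos (Real.sqrt_pos.2 hk)) hR
  have hside := hu.eventually_pos_of_pos ht
    (Real.sin θ • Complex.reCLM - Real.cos θ • Complex.imCLM) <| by
      have hprod := mul_pos hr (Real.sin_pos_of_mem_Ioo hΘ)
      rw [Real.sin_sub] at hprod
      simp only [hut, sub_apply, smul_apply, Complex.reCLM_apply,
        Complex.imCLM_apply, smul_eq_mul, cornerPos_re, cornerPos_im]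
      linarith
  simpa [mul_comm] using hside

theorem eventually_acceleration_eq_cornerField (hu : p.IsPenalizedMotionOn T u v)
    (hc : 0 < p.momentum) (hθ : p.θbar ∈ Ioo 0 Real.pi) (hk : 0 < p.k) (ht : t ∈ Ico 0 T)
    (hR : 0 < R (p.scaledTime t)) (hΘ : Θ (p.scaledTime t) ∈ Ico 0 p.θbar)
    (hut : u t = p.cornerPos R Θ t) (hvt : v t = p.cornerVel R V Θ t) :
    ∀ᶠ σ in 𝓝[>] t, p.acceleration (u σ) (v σ) = p.cornerField (u σ, v σ) := by
  have him := hu.eventually_im_pos hc hk ht hR ⟨hΘ.1, hΘ.2.trans hθ.2⟩ hut hvt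
  have hside := hu.eventually_re_mul_sin_sub_im_mul_cos_pos hk ht hR
    ⟨sub_pos.2 hΘ.2, by linarith [hΘ.1, hθ.2]⟩ hut
  filter_upwards [him, hside] with σ himσ hsideσ
  exact acceleration_eq_cornerField (Real.sin_pos_of_mem_Ioo hθ) ⟨himσ.le, hsideσ.le⟩
    fun hzero => himσ.ne' (by rw [hzero, map_zero])

theorem eq_cornerPos (hu : p.IsPenalizedMotionOn T u v) (h : p.IsScaledMotion R V Θ)
    (hα : 1 < p.α) (hθ : p.θbar ∈ Ioo 0 Real.pi) (hk : 0 < p.k) (hx₂ : p.x₂0 < 0)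
    (hv₁ : 0 < p.v₁) (hv₂ : 0 < p.v₂) (ht : t ∈ Icc p.t₀ T)
    (hΘ : Θ (p.scaledTime t) ≤ p.θbar) : u t = p.cornerPos R Θ t := by
  have hpolar := h.isPolarMotionOn hα
  have hc := momentum_pos hα hk hx₂ hv₁ hv₂
  have ht₀ := (t₀_pos hx₂ hv₂).le
  have hmono := hpolar.strictMonoOn_angle hc (convex_Ici 0)
  have hedge := hu.eqOn_edgePos hα hθ hk hv₁ hv₂ (ht.1.trans ht.2) (right_mem_Icc.2 ht₀)
  obtain ⟨hpos, hvel⟩ := Prod.mk.inj hedge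
  have hR : ∀ s ∈ Ico p.t₀ t, 0 < R (p.scaledTime s) := fun s hs =>
    h.pos _ (scaledTime_nonneg hs.1)
  have hangle : ∀ s ∈ Ico p.t₀ t, Θ (p.scaledTime s) ∈ Ico 0 p.θbar := fun s hs =>
    ⟨h.init_Θ.ge.trans (hmono.monotoneOn self_mem_Ici (scaledTime_nonneg hs.1)
      (scaledTime_nonneg hs.1)),
    (hmono (scaledTime_nonneg hs.1) (scaledTime_nonneg ht.1)
      (strictMono_scaledTime hk hs.2)).trans_le hΘ⟩
  have heqOn := hu.eqOn_of_acceleration_eq ht₀ ht.2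
    (fun s hs => contDiffAt_cornerField (cornerPos_ne_zero hk (hR s hs).ne'))
    (fun s hs => hasDerivWithinAt_cornerPos hpolar hs)
    (fun s hs => hasDerivWithinAt_cornerVel hpolar hk.le hs)
    (fun s hs => hu.eventually_acceleration_eq_cornerField hc hθ hk
      ⟨ht₀.trans hs.1, hs.2.trans_le ht.2⟩ (hR s hs) (hangle s hs))
    (hpos.trans (h.cornerPos_t₀ hv₂).symm)
    (hvel.trans (h.cornerVel_t₀ hα hk hv₁.le hv₂.le).symm)
  exact (Prod.mk.inj (heqOn (right_mem_Icc.2 ht.1))).1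

end IsPenalizedMotionOn

end CornerPhase

end ProblemData

end PenaltyCorner

end

/-- The scaled motion exists for all times; its polar angle `Θ` takes the value `θbar` at some
time `τbar > 0`; and up to that time `(R, Θ)` are the scaled polar coordinates of every solution `u`
of the penalized problem, as long as `u` is defined. -/
theorem mainTheorem10 (p : PenaltyCorner.ProblemData)
    (hα : 1 < p.α) (hθ : p.θbar ∈ Set.Ioo 0 Real.pi) (hk : 0 < p.k)
    (hx₂ : p.x₂0 < 0) (hv₁ : 0 < p.v₁) (hv₂ : 0 < p.v₂) :
    (∃ R V Θ : ℝ → ℝ, p.IsScaledMotion R V Θ) ∧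
    ∀ R V Θ : ℝ → ℝ, p.IsScaledMotion R V Θ →
      ∃ τbar ∈ Set.Ioi (0 : ℝ), Θ τbar = p.θbar ∧
        ∀ (T : ℝ) (u v : ℝ → ℂ), p.IsPenalizedMotionOn T u v →
          ∀ τ ∈ Set.Icc 0 τbar, p.t₀ + τ / √p.k ≤ T →
            u (p.t₀ + τ / √p.k) =
              ((p.η * R τ / √p.k : ℝ) : ℂ) * Complex.exp (Complex.I * (Θ τ : ℂ)) := by
  refine ⟨PenaltyCorner.ProblemData.exists_isScaledMotion hα hk hx₂ hv₁ hv₂, fun R V Θ h => ?_⟩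
  have hpolar := h.isPolarMotionOn hα
  have hc := PenaltyCorner.ProblemData.momentum_pos hα hk hx₂ hv₁ hv₂
  obtain ⟨τbar, hτbar, hΘ⟩ :=
    hpolar.exists_angle_eq (zero_le_one.trans hα.le) hc (h.init_Θ.trans_lt hθ.1)
  refine ⟨τbar, hτbar, hΘ, fun T u v hu τ hτ hT => ?_⟩
  have htime : p.scaledTime (p.t₀ + τ / √p.k) = τ :=
    PenaltyCorner.ProblemData.scaledTime_t₀_add_div hk τ
  have ht₀ : p.t₀ ≤ p.t₀ + τ / √p.k :=
    le_add_of_nonneg_right (div_nonneg hτ.1 (Real.sqrt_nonneg _))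
  have hangle : Θ τ ≤ p.θbar := hΘ ▸
    (hpolar.strictMonoOn_angle hc (convex_Ici 0)).monotoneOn hτ.1 (Ioi_subset_Ici_self hτbar) hτ.2
  rw [hu.eq_cornerPos h hα hθ hk hx₂ hv₁ hv₂ ⟨ht₀, hT⟩ (by rwa [htime]),
    PenaltyCorner.ProblemData.cornerPos_t₀_add_div hk]
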